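/- Let $k$ be a field, let $n$ be a prime number with $\operatorname{char} k\neq n$, and let $I$ be a set. Let $R=k[x_{ij}^{(\nu)} : 1\le i,j\le n,\ \nu\in I]$ be the polynomial ring in independent commuting indeterminates, let $X_\nu=(x_{ij}^{(\nu)})\in M_n(R)$ $(\nu\in I)$ be the generic $n\times n$ matrices, and let the algebra of generic matrices $k\{X\}\subseteq M_n(R)$ be the unital $k$-subalgebra generated by all the $X_\nu$. Let $\Omega$ be an algebraic closure of the field of fractions of $R$. Let $A\in k\{X\}$ be non-scalar, i.e. not of the form $c\cdot 1_n$ with $c\in R$. Then: 1. The $n$ eigenvalues of $A$ in $\Omega$, that is, the roots of its characteristic polynomial counted with multiplicity, are pairwise distinct. 2. Consequently, the elements of $k\{X\}$ commuting with $A$ are diagonalizable simultaneously with $A$, in the same basis of eigenvectors as $A$: the space $\Omega^n$ has a basis consisting of eigenvectors of $A$, and every such basis consists of eigenvectors of every $B\in k\{X\}$ with $AB=BA$. -/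

import Mathlib

noncomputable section

/-- The commutative polynomial ring `k[x_{ij}^{(ν)}]` in independent indeterminates indexed by
`ν : ι` and `i j : Fin n`. -/
abbrev GenericEntryRing (k : Type*) [Field k] (ι : Type*) (n : ℕ) :=
  MvPolynomial (ι × Fin n × Fin n) k

/-- The generic matrix `X_ν = (x_{ij}^{(ν)})`. -/
def genericMatrix (k : Type*) [Field k] {ι : Type*} (n : ℕ) (ν : ι) :
    Matrix (Fin n) (Fin n) (GenericEntryRing k ι n) :=
  Matrix.of fun i j => MvPolynomial.X (ν, i, j)

/-- The algebra of generic matrices `k{X}` of order `n`: the (unital) `k`-subalgebra of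
`M_n(k[x_{ij}^{(ν)}])` generated by the generic matrices `X_ν`. -/
def genericMatrixAlgebra (k : Type*) [Field k] (ι : Type*) (n : ℕ) :
    Subalgebra k (Matrix (Fin n) (Fin n) (GenericEntryRing k ι n)) :=
  Algebra.adjoin k (Set.range fun ν : ι => genericMatrix k n ν)

/-- The algebraic closure of the field of rational functions `k(x_{ij}^{(ν)})`. -/
abbrev EigenvalueField (k : Type*) [Field k] (ι : Type*) (n : ℕ) :=
  AlgebraicClosure (FractionRing (GenericEntryRing k ι n))

/-- A matrix over `k[x_{ij}^{(ν)}]`, viewed over the algebraic closure of `k(x_{ij}^{(ν)})`. -/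
def extendScalars {k : Type*} [Field k] {ι : Type*} {n : ℕ}
    (A : Matrix (Fin n) (Fin n) (GenericEntryRing k ι n)) :
    Matrix (Fin n) (Fin n) (EigenvalueField k ι n) :=
  A.map (algebraMap (GenericEntryRing k ι n) (EigenvalueField k ι n))

/-- The eigenvalues of a matrix, listed with their algebraic multiplicities, in the algebraic
closure of `k(x_{ij}^{(ν)})`: a multiset with `n` elements. -/
def genericEigenvalues {k : Type*} [Field k] {ι : Type*} {n : ℕ}
    (A : Matrix (Fin n) (Fin n) (GenericEntryRing k ι n)) :
    Multiset (EigenvalueField k ι n) :=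
  (extendScalars A).charpoly.roots

/-- The basis `b` consists of eigenvectors of the matrix `M`, i.e. `M` is diagonal in `b`. -/
def IsEigenbasis {L : Type*} [Field L] {n : ℕ} (M : Matrix (Fin n) (Fin n) L)
    (b : Module.Basis (Fin n) L (Fin n → L)) : Prop :=
  ∀ i, ∃ μ : L, Module.End.HasEigenvector (Matrix.toLin' M) μ (b i)

end

/-! Having pairwise distinct eigenvalues means nonzero discriminant, so it may be checked after any
specialization of the generic matrices (`of_map`). Embed `R` in an algebraically closed field `K`
with a primitive `n`-th root of unity `ζ`. The clock and shift matrices `P`, `Q` generate `M_n(K)`,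
so `quantumPlane`, which contains `uP` and `vQ`, maps onto `M_n(K)` at `u = v = 1`
(`map_evalOne_quantumPlane`). Specialize each `X_ν` to a lift `D_ν` of its image in `M_n(K)`.
Setting `u = v = 1` afterwards recovers the embedding of `R`, so a non-scalar `A` stays non-scalar.

For a non-scalar `M` in the quantum plane, `n • M - tr M` is nonzero of trace zero, and its lowest
coefficient is a nonzero multiple of some `P ^ i * Q ^ j`. Trace zero makes this non-scalar; as `n`
is prime, conjugation by `P` or `Q⁻¹` multiplies it by a primitive `n`-th root of unity. It is
invertible, so its spectrum is `n` distinct multiples of one eigenvalue. Distinctness then passes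
from the lowest coefficient to `M`.

With distinct eigenvalues, the eigenspaces of `A` are lines, preserved by every commuting matrix. -/

section

open Polynomial

/-! ### Simple spectrum and the discriminant -/

/-- The characteristic polynomial has nonzero discriminant, expressed as a resultant of fixed
size so that it commutes with all base changes. -/
def Matrix.SimpleSpectrum {S : Type*} [CommRing S] {n : ℕ} (M : Matrix (Fin n) (Fin n) S) : Prop :=
  resultant M.charpoly (derivative M.charpoly) n (n - 1) ≠ 0

theorem exists_injective_ringHom_isAlgClosed.{u} (S : Type u) [CommRing S] [IsDomain S] :
    ∃ (L : Type u) (_ : Field L) (_ : IsAlgClosed L) (φ : S →+* L), Function.Injective φ :=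
  ⟨AlgebraicClosure (FractionRing S), inferInstance, inferInstance,
    (algebraMap (FractionRing S) _).comp (algebraMap S _),
    (algebraMap (FractionRing S) _).injective.comp (IsFractionRing.injective S _)⟩

namespace Matrix.SimpleSpectrum

variable {n : ℕ}

/-- A vanishing discriminant vanishes under every ring homomorphism. No injectivity is needed, which
is what permits specialization. -/
theorem of_map {S T : Type*} [CommRing S] [CommRing T] (φ : S →+* T)
    {M : Matrix (Fin n) (Fin n) S} (h : (M.map φ).SimpleSpectrum) : M.SimpleSpectrum := by
  intro h0
  apply h
  rw [Matrix.charpoly_map, derivative_map, resultant_map_map, h0, map_zero]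

theorem map {S T : Type*} [CommRing S] [CommRing T] {φ : S →+* T}
    (hφ : Function.Injective φ) {M : Matrix (Fin n) (Fin n) S} (h : M.SimpleSpectrum) :
    (M.map φ).SimpleSpectrum := by
  rw [SimpleSpectrum, Matrix.charpoly_map, derivative_map, resultant_map_map]
  exact (map_ne_zero_iff φ hφ).mpr h

theorem iff_separable {L : Type*} [Field L] (M : Matrix (Fin n) (Fin n) L) :
    M.SimpleSpectrum ↔ M.charpoly.Separable := by
  have hdeg : M.charpoly.natDegree = n := by simp [Matrix.charpoly_natDegree_eq_dim]
  obtain ⟨k, hk⟩ := Nat.exists_eq_add_of_le (natDegree_derivative_le M.charpoly)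
  have hc : M.charpoly.coeff n = 1 := by
    simpa [hdeg] using M.charpoly_monic.coeff_natDegree
  rw [SimpleSpectrum]
  rw [hdeg] at hk
  -- The derivative may have degree below `n - 1` in positive characteristic; the excess size only
  -- contributes a power of the leading coefficient `1`.
  rw [hk, resultant_add_right_deg _ _ _ _ _ le_rfl, hc, one_pow, one_mul,
    Separable, Ne]
  have hr := resultant_eq_zero_iff (f := M.charpoly) (g := derivative M.charpoly)
  rw [hdeg] at hr
  rw [hr]
  have h0 := M.charpoly_monic.ne_zero
  exact ⟨fun h => by_contra fun h' => h ⟨Or.inl h0, h'⟩, fun h h' => h'.2 h⟩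

theorem iff_nodup_roots {L : Type*} [Field L] [IsAlgClosed L] (M : Matrix (Fin n) (Fin n) L) :
    M.SimpleSpectrum ↔ M.charpoly.roots.Nodup := by
  rw [iff_separable, nodup_roots_iff_of_splits M.charpoly_monic.ne_zero (IsAlgClosed.splits _)]

theorem iff_exists {L : Type*} [Field L] [IsAlgClosed L] (M : Matrix (Fin n) (Fin n) L) :
    M.SimpleSpectrum ↔ ∃ l : Fin n → L, Function.Injective l ∧
      ∀ i, (Matrix.scalar (Fin n) (l i) - M).det = 0 := by
  classical
  have hdeg : M.charpoly.natDegree = n := by simp [Matrix.charpoly_natDegree_eq_dim]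
  have hcard : Multiset.card M.charpoly.roots = n := by
    rw [IsAlgClosed.card_roots_eq_natDegree, hdeg]
  rw [iff_nodup_roots, ← Multiset.toFinset_card_eq_card_iff_nodup, hcard]
  have hmem : ∀ x, x ∈ M.charpoly.roots.toFinset ↔ (Matrix.scalar (Fin n) x - M).det = 0 := by
    intro x
    rw [Multiset.mem_toFinset, mem_roots M.charpoly_monic.ne_zero, IsRoot, Matrix.eval_charpoly]
  constructor
  · intro h
    let e := (M.charpoly.roots.toFinset.equivFinOfCardEq h).symm
    exact ⟨fun i => e i, Subtype.val_injective.comp e.injective, fun i => (hmem _).1 (e i).2⟩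
  · rintro ⟨l, hl, h⟩
    apply le_antisymm
    · exact (Multiset.toFinset_card_le _).trans hcard.le
    · calc n = (Finset.univ.image l).card := by simp [Finset.card_image_of_injective _ hl]
        _ ≤ _ := Finset.card_le_card (by
          intro x hx
          obtain ⟨i, -, rfl⟩ := Finset.mem_image.1 hx
          exact (hmem _).2 (h i))

/-- Simplicity of the spectrum is insensitive to affine substitutions. -/
theorem of_smul_eq {S : Type*} [CommRing S] [IsDomain S] {M M' : Matrix (Fin n) (Fin n) S}
    {a b t : S} (ha : a ≠ 0) (hb : b ≠ 0) (h : a • M = b • M' + Matrix.scalar (Fin n) t)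
    (hM' : M'.SimpleSpectrum) : M.SimpleSpectrum := by
  obtain ⟨L, _, _, φ, hinj⟩ := exists_injective_ringHom_isAlgClosed S
  have ha' : φ a ≠ 0 := (map_ne_zero_iff φ hinj).mpr ha
  have hb' : φ b ≠ 0 := (map_ne_zero_iff φ hinj).mpr hb
  obtain ⟨l, hl, hdet⟩ := (iff_exists _).1 (hM'.map hinj)
  apply of_map φ
  refine (iff_exists _).2 ⟨fun i => (φ b * l i + φ t) / φ a, fun i j hij => hl ?_, fun i => ?_⟩
  · simp only at hij
    field_simp at hij
    simpa [hb'] using hij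
  · have key : Matrix.scalar (Fin n) ((φ b * l i + φ t) / φ a) - M.map φ =
        (φ b / φ a) • (Matrix.scalar (Fin n) (l i) - M'.map φ) := by
      ext r s
      have hrs := congrArg φ (congrFun (congrFun h r) s)
      by_cases h' : r = s
      · subst h'
        simp at hrs ⊢
        field_simp
        linear_combination -hrs
      · simp [h'] at hrs ⊢
        field_simp
        linear_combination hrs
    rw [key, Matrix.det_smul, hdet, mul_zero]

/-- A matrix over `S[X]` has simple spectrum as soon as its lowest coefficient does. -/
theorem of_lowest_coeff {S : Type*} [CommRing S] [IsDomain S]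
    (M : Matrix (Fin n) (Fin n) S[X]) (e : ℕ)
    (hlow : ∀ d < e, M.map (fun p : S[X] => p.coeff d) = 0)
    (h : (M.map fun p : S[X] => p.coeff e).SimpleSpectrum) : M.SimpleSpectrum := by
  have hdvd : ∀ i j, (X : S[X]) ^ e ∣ M i j := fun i j =>
    X_pow_dvd_iff.2 fun d hd => congrFun (congrFun (hlow d hd) i) j
  choose M' hM' using hdvd
  have hM : (1 : S[X]) • M = (X : S[X]) ^ e • (Matrix.of M') + Matrix.scalar (Fin n) (0 : S[X]) := by
    ext1 i j
    simp [hM']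
  -- Divide by `X ^ e` and specialize at `X = 0`: what remains is the coefficient at `e`.
  refine of_smul_eq one_ne_zero (pow_ne_zero e X_ne_zero) hM (of_map (evalRingHom (0 : S)) ?_)
  convert h using 1
  ext i j
  simp [hM' i j, ← coeff_zero_eq_eval_zero, coeff_X_pow_mul']

end Matrix.SimpleSpectrum

/-! ### Clock and shift matrices -/

namespace Matrix

open scoped Fin.CommRing

variable {n : ℕ}

/-- The diagonal matrix with entries `1, ζ, ζ², …`. -/
def clock {K : Type*} [CommRing K] (n : ℕ) (ζ : K) : Matrix (Fin n) (Fin n) K :=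
  diagonal fun a => ζ ^ (a : ℕ)

/-- The cyclic shift matrix `e_b ↦ e_{b+1}`. -/
def shift (K : Type*) [CommRing K] (n : ℕ) [NeZero n] : Matrix (Fin n) (Fin n) K :=
  of fun a b => if a = b + 1 then 1 else 0

/-- The inverse of the cyclic shift matrix. -/
def unshift (K : Type*) [CommRing K] (n : ℕ) [NeZero n] : Matrix (Fin n) (Fin n) K :=
  of fun a b => if a + 1 = b then 1 else 0

section ClockShift

variable {K : Type*} [CommRing K] {ζ : K}

theorem clock_mul_apply (N : Matrix (Fin n) (Fin n) K) (a b : Fin n) :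
    (clock n ζ * N) a b = ζ ^ (a : ℕ) * N a b := by
  simp [clock]

theorem mul_clock_apply (N : Matrix (Fin n) (Fin n) K) (a b : Fin n) :
    (N * clock n ζ) a b = N a b * ζ ^ (b : ℕ) := by
  simp [clock]

theorem clock_pow (hζ : ζ ^ n = 1) : clock n ζ ^ n = 1 := by
  rw [clock, diagonal_pow, ← diagonal_one]
  congr 1
  ext a
  rw [Pi.pow_apply, ← pow_mul, mul_comm, pow_mul, hζ, one_pow]

variable [NeZero n]

theorem pow_val_add_one (hζ : ζ ^ n = 1) (a : Fin n) :
    ζ ^ ((a + 1 : Fin n) : ℕ) = ζ * ζ ^ (a : ℕ) := by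
  rw [Fin.val_add, ← pow_eq_pow_mod _ hζ, pow_add, Fin.val_one', ← pow_eq_pow_mod _ hζ,
    pow_one, mul_comm]

theorem unshift_mul_apply (N : Matrix (Fin n) (Fin n) K) (a b : Fin n) :
    (unshift K n * N) a b = N (a + 1) b := by
  simp [unshift, mul_apply]

theorem mul_unshift_apply (N : Matrix (Fin n) (Fin n) K) (a b : Fin n) :
    (N * unshift K n) a (b + 1) = N a b := by
  simp [unshift, mul_apply]

theorem unshift_mul_shift : unshift K n * shift K n = 1 := by
  ext a b
  rw [unshift_mul_apply]
  simp [shift, one_apply]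

theorem shift_mul_unshift : shift K n * unshift K n = 1 :=
  mul_eq_one_comm.1 unshift_mul_shift

theorem isUnit_clock (hζ : ζ ^ n = 1) : IsUnit (clock n ζ) :=
  IsUnit.of_pow_eq_one (clock_pow hζ) (NeZero.ne n)

theorem isUnit_shift : IsUnit (shift K n) :=
  ⟨⟨_, _, shift_mul_unshift, unshift_mul_shift⟩, rfl⟩

theorem isUnit_unshift : IsUnit (unshift K n) :=
  ⟨⟨_, _, unshift_mul_shift, shift_mul_unshift⟩, rfl⟩

theorem clock_mul_shift (hζ : ζ ^ n = 1) :
    clock n ζ * shift K n = ζ • (shift K n * clock n ζ) := by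
  ext a b
  rw [clock_mul_apply, smul_apply, mul_clock_apply]
  by_cases h : a = b + 1
  · subst h
    simp [shift, pow_val_add_one hζ]
  · simp [shift, h]

theorem unshift_mul_clock (hζ : ζ ^ n = 1) :
    unshift K n * clock n ζ = ζ • (clock n ζ * unshift K n) := by
  ext a b
  rw [unshift_mul_apply, smul_apply, clock_mul_apply]
  by_cases h : a + 1 = b
  · subst h
    simp [unshift, clock, pow_val_add_one hζ]
  · simp [unshift, clock, h]

theorem shift_pow_apply (k : ℕ) (a b : Fin n) :
    (shift K n ^ k) a b = if a = b + (k : Fin n) then 1 else 0 := by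
  induction k generalizing a b with
  | zero => simp [one_apply]
  | succ k ih =>
    rw [pow_succ, mul_apply]
    have h : ∀ x, shift K n x b = if x = b + 1 then 1 else 0 := fun _ => rfl
    simp only [h, mul_ite, mul_one, mul_zero, Finset.sum_ite_eq', Finset.mem_univ, if_true]
    rw [ih, Nat.cast_succ, add_assoc, add_comm 1]

end ClockShift

/-! ### Matrices commuting with clock and shift up to roots of unity -/

theorem mul_pow_eq_of_mul_eq_smul {K A : Type*} [CommRing K] [Ring A] [Algebra K A] {c : K}
    {x y : A} (h : x * y = c • (y * x)) (m : ℕ) : x * y ^ m = c ^ m • (y ^ m * x) := by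
  induction m with
  | zero => simp
  | succ m ih =>
    rw [pow_succ, ← mul_assoc, ih, smul_mul_assoc, mul_assoc, h, mul_smul_comm, smul_smul,
      ← mul_assoc, pow_succ]

theorem mul_mul_eq_of_mul_eq_smul {K A : Type*} [CommRing K] [Ring A] [Algebra K A] {c d : K}
    {x y z : A} (h : x * y = c • (y * x)) (h' : x * z = d • (z * x)) :
    x * (y * z) = (c * d) • (y * z * x) := by
  rw [← mul_assoc, h, smul_mul_assoc, mul_assoc, h', mul_smul_comm, smul_smul, mul_assoc]

section Field

variable {K : Type*} [Field K] [NeZero n] {ζ : K}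

/-- The clock matrix has distinct diagonal entries, so its centralizer is diagonal; the shift then
makes the diagonal constant. -/
theorem eq_scalar_of_commute_clock_unshift (hζ : IsPrimitiveRoot ζ n)
    {N : Matrix (Fin n) (Fin n) K} (hP : clock n ζ * N = N * clock n ζ)
    (hT : unshift K n * N = N * unshift K n) : N = scalar (Fin n) (N 0 0) := by
  have hdiag : ∀ a : Fin n, N a a = N 0 0 := by
    have hstep : ∀ a : Fin n, N (a + 1) (a + 1) = N a a := fun a => by
      rw [← unshift_mul_apply N a (a + 1), hT, mul_unshift_apply]
    have : ∀ m : ℕ, N (m : Fin n) (m : Fin n) = N 0 0 := by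
      intro m
      induction m with
      | zero => simp
      | succ m ih => rw [Nat.cast_succ, hstep, ih]
    intro a
    simpa using this a
  ext a b
  by_cases h : a = b
  · subst h
    simp [hdiag]
  · have hab := congrFun (congrFun hP a) b
    rw [clock_mul_apply, mul_clock_apply, mul_comm] at hab
    have hne : ζ ^ (a : ℕ) ≠ ζ ^ (b : ℕ) := fun h' =>
      h (Fin.ext (hζ.pow_inj a.2 b.2 h'))
    have : N a b = 0 := by
      by_contra h0
      exact hne (mul_left_cancel₀ h0 hab)
    simp [this, h]

/-- Multiplying by an invertible monomial in shift and clock with the opposite twists gives a matrix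
commuting with both, hence a nonzero scalar. The exponents `(n - 1) * j` and `(n - 1) * i` stand for
`-j` and `-i` modulo `n`. -/
theorem isUnit_of_quasiCommute (hζ : IsPrimitiveRoot ζ n)
    {N : Matrix (Fin n) (Fin n) K} {i j : ℕ} (hP : clock n ζ * N = ζ ^ j • (N * clock n ζ))
    (hT : unshift K n * N = ζ ^ i • (N * unshift K n)) (hN : N ≠ 0) : IsUnit N := by
  have hn : ζ ^ n = 1 := hζ.pow_eq_one
  have hV : IsUnit (shift K n ^ ((n - 1) * j) * clock n ζ ^ ((n - 1) * i)) :=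
    (isUnit_shift.pow _).mul ((isUnit_clock hn).pow _)
  have hcancel : ∀ m : ℕ, ζ ^ m * ζ ^ ((n - 1) * m) = 1 := fun m => by
    rw [← pow_add, show m + (n - 1) * m = n * m by
      obtain ⟨k, hk⟩ := Nat.exists_eq_succ_of_ne_zero (NeZero.ne n)
      rw [hk]
      simp
      ring, pow_mul, hn, one_pow]
  have hPV : clock n ζ * (shift K n ^ ((n - 1) * j) * clock n ζ ^ ((n - 1) * i)) =
      ζ ^ ((n - 1) * j) •
        (shift K n ^ ((n - 1) * j) * clock n ζ ^ ((n - 1) * i) * clock n ζ) := by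
    have := mul_mul_eq_of_mul_eq_smul
      (mul_pow_eq_of_mul_eq_smul (clock_mul_shift hn) ((n - 1) * j))
      (mul_pow_eq_of_mul_eq_smul (c := (1 : K)) (x := clock n ζ) (y := clock n ζ) (by simp)
        ((n - 1) * i))
    simpa using this
  have hTV : unshift K n * (shift K n ^ ((n - 1) * j) * clock n ζ ^ ((n - 1) * i)) =
      ζ ^ ((n - 1) * i) •
        (shift K n ^ ((n - 1) * j) * clock n ζ ^ ((n - 1) * i) * unshift K n) := by
    have := mul_mul_eq_of_mul_eq_smul
      (mul_pow_eq_of_mul_eq_smul (c := (1 : K)) (x := unshift K n) (y := shift K n)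
        (by rw [one_smul, unshift_mul_shift, shift_mul_unshift]) ((n - 1) * j))
      (mul_pow_eq_of_mul_eq_smul (unshift_mul_clock hn) ((n - 1) * i))
    simpa using this
  set V := shift K n ^ ((n - 1) * j) * clock n ζ ^ ((n - 1) * i)
  have h1 := mul_mul_eq_of_mul_eq_smul hP hPV
  have h2 := mul_mul_eq_of_mul_eq_smul hT hTV
  rw [hcancel, one_smul] at h1 h2
  have hs := eq_scalar_of_commute_clock_unshift hζ h1 h2
  set c := (N * V) 0 0
  have hc : c ≠ 0 := by
    intro hc
    rw [hc, map_zero] at hs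
    exact hN ((hV.mul_left_eq_zero).1 hs)
  have hu : IsUnit (N * V) := by
    rw [hs]
    exact (isUnit_iff_ne_zero.2 hc).map _
  have := hu.mul hV.unit⁻¹.isUnit
  rwa [mul_assoc, IsUnit.mul_val_inv, mul_one] at this

/-- An invertible matrix conjugate to its multiple by a primitive `n`-th root of unity has
simple spectrum. -/
theorem SimpleSpectrum.of_quasiCommute [IsAlgClosed K] {η : K} (hη : IsPrimitiveRoot η n)
    {N U : Matrix (Fin n) (Fin n) K} (hN : IsUnit N) (hU : IsUnit U)
    (h : U * N = η • (N * U)) : N.SimpleSpectrum := by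
  have hU' : U.det ≠ 0 := ((isUnit_iff_isUnit_det U).1 hU).ne_zero
  have hN' : N.det ≠ 0 := ((isUnit_iff_isUnit_det N).1 hN).ne_zero
  obtain ⟨l, hl⟩ := IsAlgClosed.exists_root N.charpoly (by
    rw [charpoly_degree_eq_dim]
    simpa using NeZero.ne n)
  rw [IsRoot, eval_charpoly] at hl
  have hl0 : l ≠ 0 := by
    rintro rfl
    apply hN'
    rw [map_zero, zero_sub, det_neg] at hl
    simpa using hl
  refine (iff_exists N).2 ⟨fun i => η ^ (i : ℕ) * l, fun i j hij => ?_, fun i => ?_⟩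
  · exact Fin.ext (hη.pow_inj i.2 j.2 (mul_right_cancel₀ hl0 hij))
  · change (scalar (Fin n) (η ^ (i : ℕ) * l) - N).det = 0
    generalize (i : ℕ) = m
    induction m with
    | zero => simpa using hl
    | succ m ih =>
      -- Conjugation by `U` carries the eigenvalue `η ^ m * l` to `η ^ (m + 1) * l`.
      have key : U * (scalar (Fin n) (η ^ (m + 1) * l) - N) =
          (η • (scalar (Fin n) (η ^ m * l) - N)) * U := by
        have hs : scalar (Fin n) (η ^ (m + 1) * l) = η • scalar (Fin n) (η ^ m * l) := by
          rw [smul_eq_diagonal_mul]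
          simp [pow_succ', mul_assoc]
        rw [mul_sub, h, hs, smul_sub, sub_mul, smul_mul_assoc, smul_mul_assoc, mul_smul_comm,
          (scalar_commute (n := Fin n) (η ^ m * l) (fun _ => mul_comm _ _) U).eq]
      have := congrArg det key
      rw [det_mul, det_mul, det_smul, ih, mul_zero, zero_mul] at this
      exact (mul_eq_zero.1 this).resolve_left hU'

/-- Since `n` is prime, each twist is either `1` or a primitive root. If both are `1`, then `N` is
scalar, and trace zero with `n ≠ 0` in `K` forces `N = 0`. -/
theorem SimpleSpectrum.of_trace_eq_zero [IsAlgClosed K] (hprime : n.Prime) (hchar : (n : K) ≠ 0)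
    (hζ : IsPrimitiveRoot ζ n)
    {N : Matrix (Fin n) (Fin n) K} {i j : ℕ} (hP : clock n ζ * N = ζ ^ j • (N * clock n ζ))
    (hT : unshift K n * N = ζ ^ i • (N * unshift K n)) (hN : N ≠ 0) (htr : N.trace = 0) :
    N.SimpleSpectrum := by
  have hn : ζ ^ n = 1 := hζ.pow_eq_one
  have hunit := isUnit_of_quasiCommute hζ hP hT hN
  have hprim : ∀ m : ℕ, ζ ^ m ≠ 1 → IsPrimitiveRoot (ζ ^ m) n := fun m hm =>
    hζ.pow_of_coprime m ((Nat.Prime.coprime_iff_not_dvd hprime).2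
      fun hd => hm ((hζ.pow_eq_one_iff_dvd m).2 hd)).symm
  by_cases hj : ζ ^ j = 1
  · by_cases hi : ζ ^ i = 1
    · rw [hj, one_smul] at hP
      rw [hi, one_smul] at hT
      have hs := eq_scalar_of_commute_clock_unshift hζ hP hT
      exfalso
      apply hN
      rw [hs] at htr
      have h0 : N 0 0 = 0 := by simpa [trace, hchar, NeZero.ne n] using htr
      rw [hs, h0, map_zero]
    · exact of_quasiCommute (hprim i hi) hunit isUnit_unshift hT
  · exact of_quasiCommute (hprim j hj) hunit (isUnit_clock hn) hP

end Field

end Matrix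

/-! ### The quantum plane and its evaluation at `u = v = 1` -/

/-- The elements `x` with `p * x = σ x * p`. -/
def twistedCentralizer {K A : Type*} [CommRing K] [Ring A] [Algebra K A] (σ : A →ₐ[K] A) (p : A) :
    Subalgebra K A where
  carrier := {x | p * x = σ x * p}
  mul_mem' {x y} hx hy := by
    change p * (x * y) = σ (x * y) * p
    rw [map_mul, ← mul_assoc, hx.out, mul_assoc, hy.out, mul_assoc]
  add_mem' {x y} hx hy := by
    change p * (x + y) = σ (x + y) * p
    rw [map_add, mul_add, hx.out, hy.out, add_mul]
  algebraMap_mem' r := by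
    change p * algebraMap K A r = σ (algebraMap K A r) * p
    rw [AlgHom.commutes, Algebra.commutes]

theorem mem_twistedCentralizer {K A : Type*} [CommRing K] [Ring A] [Algebra K A]
    {σ : A →ₐ[K] A} {p x : A} : x ∈ twistedCentralizer σ p ↔ p * x = σ x * p := Iff.rfl

namespace Matrix

open scoped Fin.CommRing

variable {n : ℕ} {K : Type*} [Field K]

/-- The automorphism of `K[u][v]` sending `v` to `ζ v`. -/
noncomputable def twistOuter (ζ : K) : K[X][X] →ₐ[K] K[X][X] :=
  (aeval (C (C ζ) * X) : K[X][X] →ₐ[K[X]] K[X][X]).restrictScalars K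

/-- The automorphism of `K[u][v]` sending `u` to `ζ u`. -/
noncomputable def twistInner (ζ : K) : K[X][X] →ₐ[K] K[X][X] :=
  mapAlgHom (aeval (C ζ * X))

theorem coeff_twistOuter (ζ : K) (p : K[X][X]) (d : ℕ) :
    (twistOuter ζ p).coeff d = C (ζ ^ d) * p.coeff d := by
  change (aeval (C (C ζ) * X) p).coeff d = _
  rw [← comp_eq_aeval, comp_C_mul_X_coeff, mul_comm, C_pow]

theorem coeff_coeff_twistInner (ζ : K) (p : K[X][X]) (d e : ℕ) :
    ((twistInner ζ p).coeff d).coeff e = ζ ^ e * (p.coeff d).coeff e := by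
  change ((p.map (RingHomClass.toRingHom (aeval (R := K) (C ζ * X)))).coeff d).coeff e = _
  rw [coeff_map]
  change (aeval (C ζ * X) (p.coeff d)).coeff e = _
  rw [← comp_eq_aeval, comp_C_mul_X_coeff, mul_comm]

/-- The matrices over `K[u][v]` whose coefficient at `u ^ i * v ^ j` is a multiple of
`P ^ i * Q ^ j`, where `P` and `Q` are the clock and shift matrices. -/
noncomputable def quantumPlane (n : ℕ) [NeZero n] (ζ : K) : Subalgebra K (Matrix (Fin n) (Fin n) K[X][X]) :=
  twistedCentralizer (twistOuter ζ).mapMatrix ((clock n ζ).map (algebraMap K K[X][X])) ⊓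
    twistedCentralizer (twistInner ζ).mapMatrix ((unshift K n).map (algebraMap K K[X][X]))

/-- Evaluation of polynomials in `K[u][v]` at `u = v = 1`. -/
noncomputable def evalOne (K : Type*) [Field K] : K[X][X] →ₐ[K] K :=
  (aeval (1 : K)).comp ((aeval (1 : K[X])).restrictScalars K)

theorem smul_map_mem_twistedCentralizer {σ : K[X][X] →ₐ[K] K[X][X]} {c : K[X][X]} {z : K}
    (hσ : σ c = algebraMap K K[X][X] z * c) {p N : Matrix (Fin n) (Fin n) K}
    (h : p * N = z • (N * p)) :
    c • N.map (algebraMap K K[X][X]) ∈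
      twistedCentralizer σ.mapMatrix (p.map (algebraMap K K[X][X])) := by
  have hfix : σ.mapMatrix (c • N.map (algebraMap K K[X][X])) =
      σ c • N.map (algebraMap K K[X][X]) := by
    ext1 i j
    change σ (c * algebraMap K K[X][X] (N i j)) = σ c * algebraMap K K[X][X] (N i j)
    rw [map_mul, AlgHom.commutes]
  have hz : (z • (N * p)).map (algebraMap K K[X][X]) =
      algebraMap K K[X][X] z • (N * p).map (algebraMap K K[X][X]) := by
    ext1 i j
    exact map_mul (algebraMap K K[X][X]) z _
  rw [mem_twistedCentralizer, hfix, hσ, mul_smul_comm, smul_mul_assoc, ← Matrix.map_mul,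
    ← Matrix.map_mul, h, hz, smul_smul, mul_comm c]

/-- The image contains the clock and shift matrices. Interpolation at the distinct powers of `ζ`
turns polynomials in the clock matrix into all diagonal matrices, and these times powers of the
shift span everything. -/
theorem map_evalOne_quantumPlane [NeZero n] {ζ : K} (hζ : IsPrimitiveRoot ζ n) :
    (quantumPlane n ζ).map (evalOne K).mapMatrix = ⊤ := by
  have hn := hζ.pow_eq_one
  have hev : ∀ (c : K[X][X]) (N : Matrix (Fin n) (Fin n) K), evalOne K c = 1 →
      (evalOne K).mapMatrix (c • N.map (algebraMap K K[X][X])) = N := by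
    intro c N hc
    ext i j
    change evalOne K (c * algebraMap K K[X][X] (N i j)) = N i j
    rw [map_mul, AlgHom.commutes, hc, one_mul, Algebra.algebraMap_self_apply]
  have hOX : twistOuter ζ X = algebraMap K K[X][X] ζ * X := by
    simp [twistOuter, IsScalarTower.algebraMap_apply K K[X] K[X][X]]
  have hOC : twistOuter ζ (C X) = C X := by
    simp [twistOuter, ← algebraMap_eq]
  have hIX : twistInner ζ X = X := by
    simp [twistInner]
  have hIC : twistInner ζ (C X) = algebraMap K K[X][X] ζ * C X := by
    simp [twistInner, IsScalarTower.algebraMap_apply K K[X] K[X][X]]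
  have hP : clock n ζ ∈ (quantumPlane n ζ).map (evalOne K).mapMatrix :=
    ⟨C X • (clock n ζ).map (algebraMap K K[X][X]),
      ⟨smul_map_mem_twistedCentralizer (z := 1) (by rw [hOC, map_one, one_mul]) (by simp),
        smul_map_mem_twistedCentralizer hIC (unshift_mul_clock hn)⟩,
      hev _ _ (by simp [evalOne])⟩
  have hQ : shift K n ∈ (quantumPlane n ζ).map (evalOne K).mapMatrix :=
    ⟨X • (shift K n).map (algebraMap K K[X][X]),
      ⟨smul_map_mem_twistedCentralizer hOX (clock_mul_shift hn),
        smul_map_mem_twistedCentralizer (z := 1) (by rw [hIX, map_one, one_mul])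
          (by rw [one_smul, unshift_mul_shift, shift_mul_unshift])⟩,
      hev _ _ (by simp [evalOne])⟩
  have hdiag : ∀ g : Fin n → K, diagonal g ∈ (quantumPlane n ζ).map (evalOne K).mapMatrix := by
    intro g
    have hinj : Set.InjOn (fun a : Fin n => ζ ^ (a : ℕ)) (Finset.univ : Finset (Fin n)) :=
      fun a _ b _ h => Fin.ext (hζ.pow_inj a.2 b.2 h)
    have : diagonal g =
        aeval (clock n ζ) (Lagrange.interpolate Finset.univ (fun a : Fin n => ζ ^ (a : ℕ)) g) := by
      change _ = aeval (diagonalAlgHom K fun a : Fin n => ζ ^ (a : ℕ)) _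
      rw [aeval_algHom_apply]
      change _ = diagonal _
      congr 1
      ext a
      rw [Polynomial.aeval_fn_apply]
      change _ = eval _ _
      rw [Lagrange.eval_interpolate_at_node _ hinj (Finset.mem_univ a)]
    rw [this]
    exact Algebra.adjoin_le (Set.singleton_subset_iff.2 hP) (aeval_mem_adjoin_singleton K _)
  rw [eq_top_iff]
  intro N _
  -- Split `N` into its cyclic diagonals `a - b = k`.
  have hN : N = ∑ k : Fin n, diagonal (fun a => N a (a - k)) * shift K n ^ (k : ℕ) := by
    ext a b
    rw [sum_apply, Finset.sum_eq_single (a - b)]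
    · simp [shift_pow_apply]
    · intro k _ hk
      have : a ≠ b + k := by
        rintro rfl
        simp at hk
      simp [shift_pow_apply, this]
    · simp
  rw [hN]
  exact Subalgebra.sum_mem _ fun k _ => Subalgebra.mul_mem _ (hdiag _) (Subalgebra.pow_mem _ hQ _)

end Matrix

/-! ### Simple spectrum in the quantum plane -/

namespace Matrix

open scoped Fin.CommRing

theorem exists_lowest_coeff {n : ℕ} {S : Type*} [CommRing S] {M : Matrix (Fin n) (Fin n) S[X]}
    (hM : M ≠ 0) : ∃ e : ℕ, (∀ d < e, M.map (fun p : S[X] => p.coeff d) = 0) ∧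
      M.map (fun p : S[X] => p.coeff e) ≠ 0 := by
  classical
  have h : ∃ e : ℕ, M.map (fun p : S[X] => p.coeff e) ≠ 0 := by
    by_contra! h
    apply hM
    ext a b e
    exact congrFun (congrFun (h e) a) b
  exact ⟨Nat.find h, fun d hd => not_not.1 (Nat.find_min h hd), Nat.find_spec h⟩

variable {n : ℕ} [NeZero n] {K : Type*} [Field K] {ζ : K}
  {M : Matrix (Fin n) (Fin n) K[X][X]}

theorem twistOuter_apply_mul (hM : M ∈ quantumPlane n ζ) (a b : Fin n) :
    algebraMap K K[X][X] (ζ ^ (a : ℕ)) * M a b =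
      twistOuter ζ (M a b) * algebraMap K K[X][X] (ζ ^ (b : ℕ)) := by
  have hc : (clock n ζ).map (algebraMap K K[X][X]) = clock n (algebraMap K K[X][X] ζ) := by
    rw [clock, clock, diagonal_map (map_zero _)]
    congr 1
    ext1 a
    exact map_pow (algebraMap K K[X][X]) ζ _
  have h := hM.1
  rw [SetLike.mem_coe, mem_twistedCentralizer, hc] at h
  have h' := congrFun (congrFun h a) b
  rw [clock_mul_apply, mul_clock_apply, ← map_pow, ← map_pow] at h'
  exact h'

theorem apply_add_one_add_one (hM : M ∈ quantumPlane n ζ) (a b : Fin n) :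
    M (a + 1) (b + 1) = twistInner ζ (M a b) := by
  have hc : (unshift K n).map (algebraMap K K[X][X]) = unshift K[X][X] n := by
    ext1 a b
    simp only [unshift, map_apply, of_apply]
    split_ifs <;> simp
  have h := hM.2
  rw [SetLike.mem_coe, mem_twistedCentralizer, hc] at h
  have h' := congrFun (congrFun h a) (b + 1)
  rw [unshift_mul_apply, mul_unshift_apply] at h'
  exact h'

theorem twistOuter_trace (hζ : IsPrimitiveRoot ζ n) (hM : M ∈ quantumPlane n ζ) :
    twistOuter ζ M.trace = M.trace := by
  rw [trace, map_sum]
  refine Finset.sum_congr rfl fun a _ => ?_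
  have h := twistOuter_apply_mul hM a a
  have h0 : algebraMap K K[X][X] (ζ ^ (a : ℕ)) ≠ 0 := by
    rw [map_ne_zero_iff _ (FaithfulSMul.algebraMap_injective K K[X][X])]
    exact pow_ne_zero _ (hζ.ne_zero (NeZero.ne n))
  rw [mul_comm] at h
  exact (mul_right_cancel₀ h0 h).symm

theorem twistInner_trace (hM : M ∈ quantumPlane n ζ) :
    twistInner ζ M.trace = M.trace := by
  rw [trace, map_sum]
  simp only [diag_apply, ← apply_add_one_add_one hM]
  exact Equiv.sum_comp (Equiv.addRight (1 : Fin n)) fun a => M a a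

/-- The trace is fixed by both twists: the outer one fixes each diagonal entry, the inner one
permutes them cyclically. -/
theorem scalar_trace_mem_quantumPlane (hζ : IsPrimitiveRoot ζ n) (hM : M ∈ quantumPlane n ζ) :
    scalar (Fin n) M.trace ∈ quantumPlane n ζ := by
  have h : scalar (Fin n) M.trace =
      M.trace • (1 : Matrix (Fin n) (Fin n) K).map (algebraMap K K[X][X]) := by
    rw [Matrix.map_one _ (map_zero _) (map_one _), smul_one_eq_diagonal, scalar_apply]
  rw [h]
  exact ⟨smul_map_mem_twistedCentralizer (z := 1)
      (by rw [twistOuter_trace hζ hM, map_one, one_mul]) (by simp),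
    smul_map_mem_twistedCentralizer (z := 1)
      (by rw [twistInner_trace hM, map_one, one_mul]) (by simp)⟩

/-- Taking the lowest coefficient in `v`, then in `u`, leaves a constant matrix on which the twists
act as `ζ ^ e` and `ζ ^ f`, still nonzero and of trace zero. -/
theorem SimpleSpectrum.of_mem_quantumPlane_of_trace_eq_zero [IsAlgClosed K] (hprime : n.Prime)
    (hchar : (n : K) ≠ 0) (hζ : IsPrimitiveRoot ζ n) (hM : M ∈ quantumPlane n ζ) (h0 : M ≠ 0)
    (htr : M.trace = 0) : M.SimpleSpectrum := by
  obtain ⟨e, he, he'⟩ := exists_lowest_coeff h0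
  obtain ⟨f, hf, hf'⟩ := exists_lowest_coeff he'
  refine of_lowest_coeff M e he (of_lowest_coeff _ f hf
    (of_trace_eq_zero (i := f) (j := e) hprime hchar hζ ?_ ?_ hf' ?_))
  · ext a b
    have h := congrArg (fun p : K[X][X] => (p.coeff e).coeff f) (twistOuter_apply_mul hM a b)
    simp only [IsScalarTower.algebraMap_apply K K[X] K[X][X], algebraMap_eq, coeff_C_mul,
      coeff_mul_C, coeff_twistOuter] at h
    rw [clock_mul_apply, smul_apply, mul_clock_apply, smul_eq_mul, ← mul_assoc]
    exact h
  · ext a b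
    obtain ⟨b, rfl⟩ : ∃ c, b = c + 1 := ⟨b - 1, by simp⟩
    have h := congrArg (fun p : K[X][X] => (p.coeff e).coeff f) (apply_add_one_add_one hM a b)
    simp only [coeff_coeff_twistInner] at h
    rw [unshift_mul_apply, smul_apply, mul_unshift_apply]
    exact h
  · have h := congrArg (fun p : K[X][X] => (p.coeff e).coeff f) htr
    simpa [trace] using h

theorem SimpleSpectrum.of_mem_quantumPlane [IsAlgClosed K] (hprime : n.Prime)
    (hchar : (n : K) ≠ 0) (hζ : IsPrimitiveRoot ζ n) (hM : M ∈ quantumPlane n ζ)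
    (h : (n : K[X][X]) • M ≠ scalar (Fin n) M.trace) : M.SimpleSpectrum := by
  have hn0 : (n : K[X][X]) ≠ 0 := by
    rw [← map_natCast (algebraMap K K[X][X])]
    exact (map_ne_zero_iff _ (FaithfulSMul.algebraMap_injective K K[X][X])).2 hchar
  have hmem : (n : K[X][X]) • M - scalar (Fin n) M.trace ∈ quantumPlane n ζ := by
    refine Subalgebra.sub_mem _ ?_ (scalar_trace_mem_quantumPlane hζ hM)
    rw [Nat.cast_smul_eq_nsmul]
    exact Subalgebra.nsmul_mem _ hM n
  refine of_smul_eq (a := (n : K[X][X])) (b := 1) (t := M.trace) hn0 one_ne_zero ?_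
    (of_mem_quantumPlane_of_trace_eq_zero hprime hchar hζ hmem (sub_ne_zero.2 h) ?_)
  · rw [one_smul, sub_add_cancel]
  · simp [trace_sub, trace_smul]

end Matrix

/-! ### Transfer to generic matrices -/

/-- A non-scalar element of the algebra of generic matrices has simple spectrum. -/
theorem Matrix.SimpleSpectrum.of_mem_genericMatrixAlgebra {k : Type*} [Field k] {ι : Type*} {n : ℕ}
    (hn : n.Prime) (hchar : (n : k) ≠ 0) {A : Matrix (Fin n) (Fin n) (GenericEntryRing k ι n)}
    (hA : A ∈ genericMatrixAlgebra k ι n)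
    (hns : ¬ ∃ c : GenericEntryRing k ι n, A = Matrix.scalar (Fin n) c) : A.SimpleSpectrum := by
  have : NeZero n := ⟨hn.ne_zero⟩
  obtain ⟨K, _, _, ψ, hψ⟩ := exists_injective_ringHom_isAlgClosed (GenericEntryRing k ι n)
  let : Algebra k K := (ψ.comp (algebraMap k (GenericEntryRing k ι n))).toAlgebra
  let ψ' : GenericEntryRing k ι n →ₐ[k] K := { ψ with commutes' := fun _ => rfl }
  have hK : (n : K) ≠ 0 := by
    rw [← map_natCast (algebraMap k K)]
    exact (map_ne_zero_iff _ (algebraMap k K).injective).2 hchar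
  have : NeZero (n : K) := ⟨hK⟩
  obtain ⟨ζ, hζ⟩ := HasEnoughRootsOfUnity.exists_primitiveRoot K n
  have hlift : ∀ ν : ι, ∃ D ∈ quantumPlane n ζ,
      (evalOne K).mapMatrix D = (genericMatrix k n ν).map ψ' := fun ν => by
    have h : (genericMatrix k n ν).map ψ' ∈ (quantumPlane n ζ).map (evalOne K).mapMatrix := by
      rw [map_evalOne_quantumPlane hζ]
      trivial
    exact h
  choose D hD hD' using hlift
  let φ : GenericEntryRing k ι n →ₐ[k] K[X][X] := MvPolynomial.aeval fun x => D x.1 x.2.1 x.2.2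
  -- Specializing to the `D ν` and then setting `u = v = 1` is the injection `ψ`; hence scalarity
  -- after `φ` descends to `A`.
  have hφ : ∀ p, evalOne K (φ p) = ψ' p := by
    intro p
    have : ((evalOne K).restrictScalars k).comp φ = ψ' := by
      refine MvPolynomial.algHom_ext fun x => ?_
      have := congrFun (congrFun (hD' x.1) x.2.1) x.2.2
      simpa [φ, genericMatrix] using this
    exact DFunLike.congr_fun this p
  have hmem : A.map φ ∈ quantumPlane n ζ := by
    have hle : genericMatrixAlgebra k ι n ≤
        ((quantumPlane n ζ).restrictScalars k).comap φ.mapMatrix := by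
      refine Algebra.adjoin_le ?_
      rintro _ ⟨ν, rfl⟩
      have : φ.mapMatrix (genericMatrix k n ν) = D ν := by
        ext1 i j
        simp [φ, genericMatrix]
      change φ.mapMatrix (genericMatrix k n ν) ∈ quantumPlane n ζ
      rw [this]
      exact hD ν
    exact hle hA
  refine of_map φ.toRingHom (of_mem_quantumPlane hn hK hζ hmem fun h => hns ?_)
  change (n : K[X][X]) • A.map φ = scalar (Fin n) (A.map φ).trace at h
  have hsc : (n : GenericEntryRing k ι n) • A = scalar (Fin n) A.trace := by
    ext1 i j
    apply hψ
    have hij := congrArg (evalOne K) (congrFun (congrFun h i) j)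
    have htr : (A.map φ).trace = φ A.trace := (AddMonoidHom.map_trace φ A).symm
    rw [htr] at hij
    have h1 : evalOne K (((n : K[X][X]) • A.map φ) i j) =
        ψ (((n : GenericEntryRing k ι n) • A) i j) := by
      simp only [smul_apply, map_apply, smul_eq_mul, map_mul, map_natCast]
      rw [hφ]
      rfl
    rw [h1] at hij
    rw [hij]
    by_cases hij' : i = j
    · subst hij'
      rw [scalar_apply, scalar_apply, diagonal_apply_eq, diagonal_apply_eq]
      exact hφ _
    · simp [hij']
  refine ⟨MvPolynomial.C (n : k)⁻¹ * A.trace, ?_⟩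
  have hinv : MvPolynomial.C (n : k)⁻¹ * (n : GenericEntryRing k ι n) = 1 := by
    rw [← map_natCast (MvPolynomial.C : k →+* _), ← map_mul, inv_mul_cancel₀ hchar, map_one]
  rw [map_mul, ← hsc, scalar_apply, ← smul_eq_diagonal_mul, smul_smul, hinv, one_smul]

/-! ### Eigenbases and commuting matrices -/

namespace Matrix

variable {L : Type*} [Field L] {n : ℕ} {M : Matrix (Fin n) (Fin n) L}

theorem SimpleSpectrum.exists_isEigenbasis [IsAlgClosed L] (h : M.SimpleSpectrum) :
    ∃ b : Module.Basis (Fin n) L (Fin n → L), IsEigenbasis M b := by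
  obtain ⟨l, hl, hdet⟩ := (iff_exists M).1 h
  have hv : ∀ i, ∃ v : Fin n → L, Module.End.HasEigenvector (toLin' M) (l i) v := fun i => by
    obtain ⟨v, hv, hMv⟩ := exists_mulVec_eq_zero_iff.2 (hdet i)
    refine ⟨v, Module.End.hasEigenvector_iff.2 ⟨Module.End.mem_eigenspace_iff.2 ?_, hv⟩⟩
    rw [sub_mulVec, sub_eq_zero, scalar_apply, ← smul_one_eq_diagonal, smul_mulVec,
      one_mulVec] at hMv
    rw [toLin'_apply, hMv]
  choose v hv using hv
  have hli : LinearIndependent L v := Module.End.eigenvectors_linearIndependent' _ l hl v hv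
  classical
  refine ⟨basisOfPiSpaceOfLinearIndependent hli, fun i => ⟨l i, ?_⟩⟩
  simpa using hv i

/-- In the basis `b` the matrix is diagonal, so the roots of its characteristic polynomial are
exactly the family `μ`, with multiplicity. -/
theorem injective_of_hasEigenvector_basis (h : M.charpoly.roots.Nodup)
    {b : Module.Basis (Fin n) L (Fin n → L)} {μ : Fin n → L}
    (hμ : ∀ i, Module.End.HasEigenvector (toLin' M) (μ i) (b i)) : Function.Injective μ := by
  have hdiag : LinearMap.toMatrix b b (toLin' M) = diagonal μ := by
    ext i j
    rw [LinearMap.toMatrix_apply, (hμ j).apply_eq_smul]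
    by_cases hij : i = j
    · subst hij
      simp
    · simp [hij]
  have hchar : M.charpoly = (((Finset.univ.val.map μ)).map fun a => X - C a).prod := by
    rw [Multiset.map_map, ← charpoly_toLin', ← LinearMap.charpoly_toMatrix _ b, hdiag, charpoly_diagonal]
    rfl
  rw [hchar, roots_multiset_prod_X_sub_C] at h
  intro i j hij
  exact Multiset.inj_on_of_nodup_map h i (Finset.mem_univ i) j (Finset.mem_univ j) hij

theorem isEigenbasis_of_commute (h : M.charpoly.roots.Nodup)
    {b : Module.Basis (Fin n) L (Fin n → L)} (hb : IsEigenbasis M b)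
    {N : Matrix (Fin n) (Fin n) L} (hMN : Commute M N) : IsEigenbasis N b := by
  choose μ hμ using hb
  have hinj := injective_of_hasEigenvector_basis h hμ
  intro i
  refine ⟨b.repr (toLin' N (b i)) i, Module.End.hasEigenvector_iff.2
    ⟨Module.End.mem_eigenspace_iff.2 ?_, b.ne_zero i⟩⟩
  -- `N` preserves the `μ i`-eigenspace of `M`; comparing coordinates, those at `j ≠ i` vanish
  -- because `μ j ≠ μ i`.
  have hcomm : toLin' M (toLin' N (b i)) = μ i • toLin' N (b i) := by
    rw [← toLin'_mul_apply, hMN.eq, toLin'_mul_apply, (hμ i).apply_eq_smul, map_smul]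
  have hrepr : ∀ v j, b.repr (toLin' M v) j = μ j * b.repr v j := by
    intro v j
    have : toLin' M v = ∑ l, (b.repr v l * μ l) • b l := by
      conv_lhs => rw [← b.sum_repr v, map_sum]
      refine Finset.sum_congr rfl fun l _ => ?_
      rw [map_smul, (hμ l).apply_eq_smul, smul_smul]
    rw [this, b.repr_sum_self, mul_comm]
  apply b.ext_elem
  intro j
  by_cases hij : j = i
  · subst hij
    simp
  · have hj := congrArg (fun v => b.repr v j) hcomm
    simp only [hrepr, map_smul, Finsupp.smul_apply, smul_eq_mul] at hj
    have hz : b.repr (toLin' N (b i)) j = 0 := by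
      by_contra h0
      exact hij (hinj (mul_right_cancel₀ h0 hj))
    rw [hz, map_smul, Finsupp.smul_apply, b.repr_self, Finsupp.single_apply,
      if_neg (Ne.symm hij), smul_zero]

end Matrix

end

theorem mainTheorem4 (k : Type*) [Field k] (ι : Type*) (n : ℕ) (hn : n.Prime)
    (hchar : (n : k) ≠ 0)
    (A : Matrix (Fin n) (Fin n) (GenericEntryRing k ι n))
    (hA : A ∈ genericMatrixAlgebra k ι n)
    (hns : ¬ ∃ c : GenericEntryRing k ι n, A = Matrix.scalar (Fin n) c) :
    (genericEigenvalues A).Nodup ∧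
    (∃ b : Module.Basis (Fin n) (EigenvalueField k ι n) (Fin n → EigenvalueField k ι n),
      IsEigenbasis (extendScalars A) b) ∧
    (∀ b : Module.Basis (Fin n) (EigenvalueField k ι n) (Fin n → EigenvalueField k ι n),
      IsEigenbasis (extendScalars A) b →
      ∀ B ∈ genericMatrixAlgebra k ι n, Commute A B → IsEigenbasis (extendScalars B) b) := by
  have hinj : Function.Injective
      (algebraMap (GenericEntryRing k ι n) (EigenvalueField k ι n)) := by
    rw [IsScalarTower.algebraMap_eq (GenericEntryRing k ι n)
      (FractionRing (GenericEntryRing k ι n)) (EigenvalueField k ι n)]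
    exact (algebraMap (FractionRing (GenericEntryRing k ι n)) _).injective.comp
      (IsFractionRing.injective _ _)
  have hsimple : (extendScalars A).SimpleSpectrum :=
    (Matrix.SimpleSpectrum.of_mem_genericMatrixAlgebra hn hchar hA hns).map hinj
  have hnodup := (Matrix.SimpleSpectrum.iff_nodup_roots _).1 hsimple
  refine ⟨hnodup, hsimple.exists_isEigenbasis, fun b hb B _ hAB =>
    Matrix.isEigenbasis_of_commute hnodup hb ?_⟩
  exact hAB.map (algebraMap (GenericEntryRing k ι n) (EigenvalueField k ι n)).mapMatrix
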